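/- Let $\Bbbk$ be a field, let $m\ge 2$, and let $S\subseteq\mathbb Z_{\ge0}$ be a numerical semigroup (a submonoid with finite complement) of multiplicity $m=\min(S\setminus\{0\})$. Put $[m-1]=\{1,\dots,m-1\}$. For $i\in[m-1]$ let $a_i$ be the least element of $S$ with $a_i\equiv i \bmod m$, and put $a_0=m$. Indices are added modulo $m$. For $i,j\in[m-1]$ put $c_{i,j}=\frac1m(a_i+a_j-a_{i+j})$, and $b_{i,j}=c_{i,j}$ if $i+j\neq m$, $b_{i,j}=c_{i,j}+1$ if $i+j=m$. Let $R=\Bbbk[x_0,\dots,x_{m-1}]$, $y=x_0$, and $\mathfrak m=\langle x_0,\dots,x_{m-1}\rangle$. The Apéry resolution $\mathcal F_\bullet$ of the ideal $J_S=\ker\big(R\to\Bbbk[t],\ x_i\mapsto t^{a_i}\big)$ consists of the following modules and maps. $F_0=R$, and for $d\ge1$, $F_d$ is the free $R$-module with basis the symbols $e_{i,A}$ with $i\in[m-1]$, $A\subseteq[m-1]$, $|A|=d$, $i\ge\min A$. For $j\in A$ let $\operatorname{sign}(j,A)=(-1)^{|\{\ell\in A:\ \ell<j\}|}$. Put $e_{0,A}=0$,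 and $e_{i,A}=\sum_{j\in A}\operatorname{sign}(j,A)\,e_{j,(A\cup\{i\})\setminus\{j\}}$ if $1\le i<\min A$. The map $\partial_1:F_1\to F_0$ is given by $e_{i,\{j\}}\mapsto x_ix_j-y^{c_{i,j}}x_{i+j}$, and for $d\ge2$ the map $\partial_d:F_d\to F_{d-1}$ is given on basis elements by $$e_{i,A}\mapsto\sum_{j\in A}\operatorname{sign}(j,A)\big(x_j\,e_{i,A\setminus\{j\}}-y^{b_{i,j}}\,e_{i+j,A\setminus\{j\}}\big).$$ The following are equivalent: 1. $\mathcal F_\bullet$ is minimal, i.e. $\partial_d(F_d)\subseteq\mathfrak m F_{d-1}$ for all $d\ge1$; 2. no matrix of a map $\partial_d$, $d\ge1$, with respect to the given bases has an entry that is a nonzero constant; 3. $S$ has maximal embedding dimension, i.e. $\{a_0,a_1,\dots,a_{m-1}\}$ is the minimal generating set of $S$; 4. $b_{i,j}>0$ for all $i,j\in[m-1]$; 5. the Apéry coordinate vector $(a_1,\dots,a_{m-1})$ lies in the interior (in $\mathbb R^{m-1}$) of the Kunz cone $$C_m=\{z\in\mathbb R_{\ge0}^{m-1} : z_i+z_j\ge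 z_{i+j}\ \text{for all } i,j\in[m-1] \text{ with } i+j\ne m\}.$$ -/

import Mathlib

noncomputable section

namespace Apery

/-! Indices live in `Fin m`: its addition is addition modulo `m`, its order is the order of
`0 < 1 < ⋯ < m - 1`, and its nonzero elements form `[m-1]`. -/

/-- `a_i`: the least element of `S` congruent to `i` modulo `m` for `i ≠ 0`, with the
convention `a_0 = m`. -/
def a (S : AddSubmonoid ℕ) (m : ℕ) [NeZero m] (i : Fin m) : ℕ :=
  if i = 0 then m else sInf {n : ℕ | n ∈ S ∧ n % m = (i : ℕ)}

/-- `c_{i,j} = (a_i + a_j - a_{i+j}) / m`. Subtraction and division are exact when `S` is a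
numerical semigroup of multiplicity `m`, see `m_mul_c`. -/
def c (S : AddSubmonoid ℕ) (m : ℕ) [NeZero m] (i j : Fin m) : ℕ :=
  (a S m i + a S m j - a S m (i + j)) / m

/-- `b_{i,j}` is `c_{i,j} + 1` if `i + j = m`, and `c_{i,j}` otherwise. -/
def b (S : AddSubmonoid ℕ) (m : ℕ) [NeZero m] (i j : Fin m) : ℕ :=
  if i + j = 0 then c S m i j + 1 else c S m i j

/-- `S` has maximal embedding dimension: `{a_0, …, a_{m-1}}` is the minimal generating set
of `S`. -/
def IsMED (S : AddSubmonoid ℕ) (m : ℕ) [NeZero m] : Prop :=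
  Minimal (fun G : Set ℕ => AddSubmonoid.closure G = S) (Set.range (a S m))

/-- The Kunz cone `C_m` in `ℝ^{m-1}`. -/
def kunzCone (m : ℕ) [NeZero m] : Set ({i : Fin m // i ≠ 0} → ℝ) :=
  {z | (∀ i, 0 ≤ z i) ∧
    ∀ (i j : {i : Fin m // i ≠ 0}) (h : (i : Fin m) + j ≠ 0), z ⟨i + j, h⟩ ≤ z i + z j}

/-- The Apéry coordinate vector `(a_1, …, a_{m-1})`. -/
def coordVector (S : AddSubmonoid ℕ) (m : ℕ) [NeZero m] : {i : Fin m // i ≠ 0} → ℝ :=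
  fun i => (a S m i : ℝ)

/-- The labels `(i, A)` of the basis elements `e_{i,A}` of `F_d` for `d ≥ 1`: `i ∈ [m-1]`,
`A ⊆ [m-1]`, `|A| = d` and `i ≥ min A`. -/
structure BasisLabel (m d : ℕ) [NeZero m] where
  i : Fin m
  A : Finset (Fin m)
  i_ne_zero : i ≠ 0
  zero_notMem : 0 ∉ A
  card_eq : A.card = d
  min_le : ∃ j ∈ A, j ≤ i

/-- The labels of the basis of `F_d`; `F_0 = R e_∅` has rank one. -/
def Label (m : ℕ) [NeZero m] : ℕ → Type
  | 0 => Unit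
  | d + 1 => BasisLabel m (d + 1)

/-- The free module `F_d` over `R = k[x_0, …, x_{m-1}]`, where `x_0 = y`. -/
abbrev F (k : Type*) [Field k] (m : ℕ) [NeZero m] (d : ℕ) : Type _ :=
  Label m d →₀ MvPolynomial (Fin m) k

/-- `sign(j, A) = (-1)^t`, where `t` is the number of elements of `A` below `j`. -/
def sign {m : ℕ} (j : Fin m) (A : Finset (Fin m)) : ℤ :=
  (-1) ^ (A.filter (· < j)).card

open Classical in
/-- The basis vector `e_{i,A}` of `F_{d+1}` if `(i, A)` is one of its labels, and `0`
otherwise. -/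
def basisVec (k : Type*) [Field k] (m : ℕ) [NeZero m] (d : ℕ) (i : Fin m)
    (A : Finset (Fin m)) : F k m (d + 1) :=
  if h : i ≠ 0 ∧ 0 ∉ A ∧ A.card = d + 1 ∧ ∃ j ∈ A, j ≤ i then
    Finsupp.single (⟨i, A, h.1, h.2.1, h.2.2.1, h.2.2.2⟩ : BasisLabel m (d + 1)) 1
  else 0

open Classical in
/-- The element `e_{i,A}` of `F_{d+1}` for arbitrary `i` and `A ⊆ [m-1]` with `|A| = d + 1`:
`e_{0,A} = 0`, and `e_{i,A} = ∑_{j ∈ A} sign(j,A) e_{j, A ∪ i ∖ j}` if `0 ≠ i < min A`. -/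
def e (k : Type*) [Field k] (m : ℕ) [NeZero m] (d : ℕ) (i : Fin m)
    (A : Finset (Fin m)) : F k m (d + 1) :=
  if i = 0 then 0
  else if ∃ j ∈ A, j ≤ i then basisVec k m d i A
  else ∑ j ∈ A, sign j A • basisVec k m d j ((insert i A).erase j)

/-- The map `∂_{d+1} : F_{d+1} → F_d`. For `d = 0` the set `A` is a singleton `{j}` and
`e_{i,{j}} ↦ x_i x_j - y^{c_{i,j}} x_{i+j}`; for `d ≥ 1`,
`e_{i,A} ↦ ∑_{j ∈ A} sign(j,A) (x_j e_{i, A ∖ j} - y^{b_{i,j}} e_{i+j, A ∖ j})`. -/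
def boundary (k : Type*) [Field k] (S : AddSubmonoid ℕ) (m : ℕ) [NeZero m] :
    (d : ℕ) → F k m (d + 1) →ₗ[MvPolynomial (Fin m) k] F k m d
  | 0 => Finsupp.linearCombination _ fun p : BasisLabel m 1 =>
      ∑ j ∈ p.A, Finsupp.single () (MvPolynomial.X p.i * MvPolynomial.X j -
        MvPolynomial.X 0 ^ c S m p.i j * MvPolynomial.X (p.i + j))
  | d + 1 => Finsupp.linearCombination _ fun p : BasisLabel m (d + 2) =>
      ∑ j ∈ p.A, sign j p.A •
        ((MvPolynomial.X j : MvPolynomial (Fin m) k) • e k m d p.i (p.A.erase j) -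
          (MvPolynomial.X 0 ^ b S m p.i j : MvPolynomial (Fin m) k) •
            e k m d (p.i + j) (p.A.erase j))

/-- The entry of the matrix of `∂_{d+1}` in column `p` and row `q`. -/
def entry (k : Type*) [Field k] (S : AddSubmonoid ℕ) (m : ℕ) [NeZero m] (d : ℕ)
    (q : Label m d) (p : Label m (d + 1)) : MvPolynomial (Fin m) k :=
  boundary k S m d (Finsupp.single p 1) q

/-- No matrix of the Apéry resolution has an entry that is a nonzero constant. -/
def NoConstantEntries (k : Type*) [Field k] (S : AddSubmonoid ℕ) (m : ℕ) [NeZero m] : Prop :=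
  ∀ (d : ℕ) (q : Label m d) (p : Label m (d + 1)) (u : k), u ≠ 0 →
    entry k S m d q p ≠ MvPolynomial.C u

/-- The Apéry resolution is minimal: every `∂_{d+1}` maps `F_{d+1}` into `𝔪 F_d`, where
`𝔪 = ⟨x_0, …, x_{m-1}⟩`. -/
def IsMinimal (k : Type*) [Field k] (S : AddSubmonoid ℕ) (m : ℕ) [NeZero m] : Prop :=
  ∀ d : ℕ, LinearMap.range (boundary k S m d) ≤
    Ideal.span (Set.range (MvPolynomial.X : Fin m → MvPolynomial (Fin m) k)) •
      (⊤ : Submodule (MvPolynomial (Fin m) k) (F k m d))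

theorem a_spec {S : AddSubmonoid ℕ} {m : ℕ} [NeZero m] (hS : ((S : Set ℕ)ᶜ).Finite)
    (hm : IsLeast {n : ℕ | n ∈ S ∧ n ≠ 0} m) (i : Fin m) :
    a S m i ∈ S ∧ a S m i % m = (i : ℕ) := by
  unfold a
  split_ifs with h
  · subst h
    exact ⟨hm.1.1, by simp⟩
  · apply Nat.sInf_mem (s := {n : ℕ | n ∈ S ∧ n % m = (i : ℕ)})
    obtain ⟨N, hN⟩ := hS.bddAbove
    refine ⟨(i : ℕ) + m * (N + 1), ?_, ?_⟩
    · by_contra hc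
      have h1 := hN hc
      have h2 : 1 ≤ m := Nat.one_le_iff_ne_zero.mpr (NeZero.ne m)
      nlinarith
    · rw [Nat.add_mul_mod_self_left, Nat.mod_eq_of_lt i.2]

/-- The defining equation of `c_{i,j}` over `ℤ`. -/
theorem m_mul_c {S : AddSubmonoid ℕ} {m : ℕ} [NeZero m] (hS : ((S : Set ℕ)ᶜ).Finite)
    (hm : IsLeast {n : ℕ | n ∈ S ∧ n ≠ 0} m) {i : Fin m} (hi : i ≠ 0) (j : Fin m) :
    (m : ℤ) * c S m i j = a S m i + a S m j - a S m (i + j) := by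
  have hai := a_spec hS hm i
  have haj := a_spec hS hm j
  have hk := a_spec hS hm (i + j)
  have hmod : (a S m i + a S m j) % m = ((i + j : Fin m) : ℕ) := by
    rw [Nat.add_mod, hai.2, haj.2, Fin.val_add]
  have hle : a S m (i + j) ≤ a S m i + a S m j := by
    by_cases h0 : i + j = 0
    · have hi0 : a S m i ≠ 0 := by
        intro h
        apply hi
        apply Fin.ext
        rw [← hai.2, h]
        simp
      have := hm.2 ⟨hai.1, hi0⟩
      have h2 : a S m (i + j) = m := by simp [a, h0]
      omega
    · have h2 : a S m (i + j) = sInf {n : ℕ | n ∈ S ∧ n % m = ((i + j : Fin m) : ℕ)} := by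
        rw [a, if_neg h0]
      rw [h2]
      exact Nat.sInf_le ⟨S.add_mem hai.1 haj.1, hmod⟩
  have hdvd : m ∣ a S m i + a S m j - a S m (i + j) :=
    (Nat.modEq_iff_dvd' hle).mp (hk.2.trans hmod.symm)
  have := Nat.mul_div_cancel' hdvd
  unfold c
  zify [hle] at this
  exact_mod_cast this

end Apery

end

/-! Every condition is compared with positivity of all `b S m i j`. By `b_pos_iff`, `b S m i j`
vanishes exactly when `i + j ≠ 0` and `a_{i+j} = a_i + a_j`. Such an equality makes the generator
`a_{i+j}` redundant (`isMED_iff`) and puts the coordinate vector on a facet inequality of the cone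
(`coordVector_mem_interior_iff`). In the resolution the only coefficients beyond `∂_1` are `± x_j`
and `± y^b`, so positive exponents give minimality, while a zero exponent leaves a visible unit `±
1` in `∂_2` (`exists_entry_eq_C`). -/

namespace Apery

open MvPolynomial

/-! ### Generators of the semigroup and the Kunz cone -/

section Semigroup

variable {S : AddSubmonoid ℕ} {m : ℕ} [NeZero m]

theorem a_zero : a S m 0 = m := by simp [a]

theorem a_le {i : Fin m} (hi : i ≠ 0) {n : ℕ} (hn : n ∈ S) (h : n % m = i) : a S m i ≤ n := by
  rw [a, if_neg hi]
  exact Nat.sInf_le ⟨hn, h⟩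

theorem a_pos (hS : ((S : Set ℕ)ᶜ).Finite)
    (hm : IsLeast {n : ℕ | n ∈ S ∧ n ≠ 0} m) (i : Fin m) : 0 < a S m i := by
  by_cases hi : i = 0
  · rw [hi, a_zero]
    exact Nat.pos_of_ne_zero (NeZero.ne m)
  · refine Nat.pos_of_ne_zero fun h => hi (Fin.ext ?_)
    rw [← (a_spec hS hm i).2, h]
    simp

theorem b_comm (i j : Fin m) : b S m i j = b S m j i := by
  simp only [b, c, add_comm]

/-- The convention `a_0 = m` instead of `0` lowers `c` by one when `i + j = 0`; the shift in `b`
undoes this, matching the absence of a cone inequality there. -/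
theorem b_pos_iff (hS : ((S : Set ℕ)ᶜ).Finite) (hm : IsLeast {n : ℕ | n ∈ S ∧ n ≠ 0} m)
    {i j : Fin m} (hi : i ≠ 0) :
    0 < b S m i j ↔ (i + j ≠ 0 → a S m (i + j) < a S m i + a S m j) := by
  by_cases h : i + j = 0
  · simp [b, h]
  · have hc := m_mul_c hS hm hi j
    have hm0 : (0 : ℤ) < m := by exact_mod_cast Nat.pos_of_ne_zero (NeZero.ne m)
    have hb : b S m i j = c S m i j := by simp [b, h]
    rw [hb, ← Int.natCast_pos, ← mul_pos_iff_of_pos_left hm0, hc]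
    simp only [ne_eq, h, not_false_eq_true, true_imp_iff]
    omega

theorem a_add_of_b_eq_zero (hS : ((S : Set ℕ)ᶜ).Finite)
    (hm : IsLeast {n : ℕ | n ∈ S ∧ n ≠ 0} m) {i j : Fin m} (hi : i ≠ 0)
    (h : b S m i j = 0) : i + j ≠ 0 ∧ a S m (i + j) = a S m i + a S m j := by
  have h0 : i + j ≠ 0 := fun h0 => by simp [b, h0] at h
  refine ⟨h0, ?_⟩
  have hc := m_mul_c hS hm hi j
  have hb : c S m i j = 0 := by simpa [b, h0] using h
  rw [hb] at hc
  push_cast at hc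
  omega

theorem closure_range_a (hS : ((S : Set ℕ)ᶜ).Finite)
    (hm : IsLeast {n : ℕ | n ∈ S ∧ n ≠ 0} m) : AddSubmonoid.closure (Set.range (a S m)) = S := by
  have hmpos : 0 < m := Nat.pos_of_ne_zero (NeZero.ne m)
  apply le_antisymm
  · rw [AddSubmonoid.closure_le]
    rintro _ ⟨i, rfl⟩
    exact (a_spec hS hm i).1
  · intro n hn
    have hmul : ∀ t : ℕ, t * m ∈ AddSubmonoid.closure (Set.range (a S m)) := fun t => by
      rw [← smul_eq_mul]
      exact nsmul_mem (AddSubmonoid.subset_closure (Set.mem_range.mpr ⟨0, a_zero⟩)) t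
    let i : Fin m := ⟨n % m, Nat.mod_lt _ hmpos⟩
    by_cases hi : i = 0
    · have h0 : n % m = 0 := by simpa [i] using congrArg Fin.val hi
      obtain ⟨t, rfl⟩ := Nat.dvd_of_mod_eq_zero h0
      rw [mul_comm]
      exact hmul t
    · have hle : a S m i ≤ n := a_le hi hn rfl
      obtain ⟨t, ht⟩ := (Nat.modEq_iff_dvd' hle).mp ((a_spec hS hm i).2.trans rfl)
      have : n = a S m i + t * m := by rw [mul_comm]; omega
      rw [this]
      exact add_mem (AddSubmonoid.subset_closure ⟨i, rfl⟩) (hmul t)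

theorem mem_of_mem_closure_of_irreducible {G : Set ℕ} {n : ℕ}
    (hn : n ∈ AddSubmonoid.closure G) (h0 : n ≠ 0)
    (hirr : ∀ s ∈ AddSubmonoid.closure G, ∀ t ∈ AddSubmonoid.closure G,
      s + t = n → s = 0 ∨ t = 0) : n ∈ G := by
  induction hn using AddSubmonoid.closure_induction with
  | mem x hx => exact hx
  | zero => exact absurd rfl h0
  | add x y hx hy ihx ihy =>
    rcases hirr x hx y hy rfl with rfl | rfl
    · rw [zero_add] at *
      exact ihy h0 hirr
    · rw [add_zero] at *
      exact ihx h0 hirr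

/-- If a summand has residue `0`, the other is a smaller element in the class of `a_i`. Otherwise
the summands are at least `a_p` and `a_q`, whose sum strictly exceeds `a_{p+q} = a_i`. -/
theorem a_irreducible (hS : ((S : Set ℕ)ᶜ).Finite) (hm : IsLeast {n : ℕ | n ∈ S ∧ n ≠ 0} m)
    (hb : ∀ i j : Fin m, i ≠ 0 → j ≠ 0 → 0 < b S m i j) (i : Fin m) {s t : ℕ}
    (hs : s ∈ S) (ht : t ∈ S) (hst : s + t = a S m i) : s = 0 ∨ t = 0 := by
  have hmpos : 0 < m := Nat.pos_of_ne_zero (NeZero.ne m)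
  by_contra! hne
  obtain ⟨hs0, ht0⟩ := hne
  by_cases hi : i = 0
  · rw [hi, a_zero] at hst
    have := hm.2 ⟨hs, hs0⟩
    omega
  · have hmod : (s + t) % m = i := by rw [hst]; exact (a_spec hS hm i).2
    let p : Fin m := ⟨s % m, Nat.mod_lt _ hmpos⟩
    let q : Fin m := ⟨t % m, Nat.mod_lt _ hmpos⟩
    have hpq : p + q = i := Fin.ext (by rw [Fin.val_add, ← hmod, Nat.add_mod s t])
    by_cases hp : p = 0
    · have h := a_le (S := S) hi ht (by rw [← hpq, hp, zero_add])
      omega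
    by_cases hq : q = 0
    · have h := a_le (S := S) hi hs (by rw [← hpq, hq, add_zero])
      omega
    have h1 : a S m p ≤ s := a_le hp hs rfl
    have h2 : a S m q ≤ t := a_le hq ht rfl
    have h3 := (b_pos_iff hS hm hp).mp (hb p q hp hq) (hpq ▸ hi)
    rw [hpq] at h3
    omega

theorem isMED_iff (hS : ((S : Set ℕ)ᶜ).Finite) (hm : IsLeast {n : ℕ | n ∈ S ∧ n ≠ 0} m) :
    IsMED S m ↔ ∀ i j : Fin m, i ≠ 0 → j ≠ 0 → 0 < b S m i j := by
  constructor
  · intro hmin i j hi hj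
    by_contra hb
    obtain ⟨hk, hadd⟩ := a_add_of_b_eq_zero hS hm hi (Nat.eq_zero_of_not_pos hb)
    have hai := a_pos hS hm i
    have haj := a_pos hS hm j
    -- `a_i` and `a_j` are positive, hence differ from their sum and survive its removal.
    have hG : AddSubmonoid.closure (Set.range (a S m) \ {a S m (i + j)}) = S := by
      apply le_antisymm
      · exact (AddSubmonoid.closure_mono Set.sdiff_subset).trans (closure_range_a hS hm).le
      · rw [← closure_range_a hS hm, AddSubmonoid.closure_le, closure_range_a hS hm]
        rintro _ ⟨l, rfl⟩
        by_cases hl : a S m l = a S m (i + j)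
        · rw [hl, hadd]
          refine add_mem (AddSubmonoid.subset_closure ⟨⟨i, rfl⟩, ?_⟩)
            (AddSubmonoid.subset_closure ⟨⟨j, rfl⟩, ?_⟩)
          all_goals
            rw [Set.mem_singleton_iff]
            omega
        · exact AddSubmonoid.subset_closure ⟨⟨l, rfl⟩, hl⟩
    exact (hmin.2 hG Set.sdiff_subset ⟨i + j, rfl⟩).2 rfl
  · intro hb
    refine ⟨closure_range_a hS hm, fun G hG _ => ?_⟩
    rintro _ ⟨i, rfl⟩
    dsimp only at hG
    -- An irreducible element belongs to every generating set.
    refine mem_of_mem_closure_of_irreducible (hG ▸ (a_spec hS hm i).1) (a_pos hS hm i).ne' ?_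
    rw [hG]
    exact fun s hs t ht => a_irreducible hS hm hb i hs ht

theorem coordVector_mem_interior_iff (hS : ((S : Set ℕ)ᶜ).Finite)
    (hm : IsLeast {n : ℕ | n ∈ S ∧ n ≠ 0} m) :
    coordVector S m ∈ interior (kunzCone m) ↔
      ∀ i j : Fin m, i ≠ 0 → j ≠ 0 → 0 < b S m i j := by
  constructor
  · intro hint i j hi hj
    by_contra hb
    obtain ⟨hk, hadd⟩ := a_add_of_b_eq_zero hS hm hi (Nat.eq_zero_of_not_pos hb)
    have hik : (⟨i, hi⟩ : {i : Fin m // i ≠ 0}) ≠ ⟨i + j, hk⟩ := fun h =>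
      hj (by simpa using congrArg Subtype.val h)
    have hjk : (⟨j, hj⟩ : {i : Fin m // i ≠ 0}) ≠ ⟨i + j, hk⟩ := fun h =>
      hi (by simpa using congrArg Subtype.val h)
    -- Raising only coordinate `i + j` breaks the tight inequality, because neither `i` nor `j`
    -- equals `i + j`.
    let z : ℝ → {i : Fin m // i ≠ 0} → ℝ := fun t =>
      Function.update (coordVector S m) ⟨i + j, hk⟩ (coordVector S m ⟨i + j, hk⟩ + t)
    have hz : Continuous z := continuous_const.update _ (continuous_const.add continuous_id)
    have hz0 : z 0 ∈ interior (kunzCone m) := by simpa [z] using hint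
    have hev : ∀ᶠ t in nhds (0 : ℝ), z t ∈ interior (kunzCone m) :=
      hz.continuousAt.eventually_mem (isOpen_interior.mem_nhds hz0)
    obtain ⟨t, ht, hpos⟩ := ((hev.filter_mono nhdsWithin_le_nhds).and
      (self_mem_nhdsWithin : Set.Ioi (0 : ℝ) ∈ nhdsWithin 0 (Set.Ioi 0))).exists
    have hle := (interior_subset ht).2 ⟨i, hi⟩ ⟨j, hj⟩ hk
    have hadd' : (a S m (i + j) : ℝ) = a S m i + a S m j := by exact_mod_cast hadd
    simp only [z, Function.update_self, Function.update_of_ne hik, Function.update_of_ne hjk,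
      coordVector, hadd'] at hle
    have : (0 : ℝ) < t := hpos
    linarith
  · intro hb
    -- The strict inequalities are finitely many, so they cut out an open subset of the cone.
    let U : Set ({i : Fin m // i ≠ 0} → ℝ) := {z | (∀ i, 0 < z i) ∧
      ∀ (i j : {i : Fin m // i ≠ 0}) (h : (i : Fin m) + j ≠ 0), z ⟨i + j, h⟩ < z i + z j}
    have hU : IsOpen U := by
      have hUeq : U = (⋂ i, {z | 0 < z i}) ∩
          ⋂ (i : {i : Fin m // i ≠ 0}) (j : {i : Fin m // i ≠ 0}) (h : (i : Fin m) + j ≠ 0),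
            {z | z ⟨i + j, h⟩ < z i + z j} := by
        ext z
        simp [U]
      rw [hUeq]
      exact (isOpen_iInter_of_finite fun i => isOpen_lt continuous_const (continuous_apply i)).inter
        (isOpen_iInter_of_finite fun i => isOpen_iInter_of_finite fun j =>
          isOpen_iInter_of_finite fun h => isOpen_lt (continuous_apply _)
            ((continuous_apply i).add (continuous_apply j)))
    have hsub : U ⊆ kunzCone m := fun z hz => ⟨fun i => (hz.1 i).le, fun i j h => (hz.2 i j h).le⟩
    refine interior_maximal hsub hU (show _ ∧ _ from ⟨fun i => ?_, fun i j h => ?_⟩)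
    · exact Nat.cast_pos.mpr (a_pos hS hm i)
    · unfold coordVector
      exact_mod_cast (b_pos_iff hS hm i.2).mp (hb i j i.2 j.2) h

end Semigroup

/-! ### Constant entries of the Apéry resolution -/

section Resolution

variable {k : Type*} [Field k] {S : AddSubmonoid ℕ} {m : ℕ} [NeZero m]

theorem boundary_zero_single (p : BasisLabel m 1) :
    boundary k S m 0 (Finsupp.single (show Label m 1 from p) 1) =
      ∑ j ∈ p.A, Finsupp.single (show Label m 0 from ()) (X p.i * X j -
        X 0 ^ c S m p.i j * X (p.i + j)) :=
  (Finsupp.linearCombination_single _ _ _).trans (one_smul _ _)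

theorem boundary_succ_single (d : ℕ) (p : BasisLabel m (d + 2)) :
    boundary k S m (d + 1) (Finsupp.single (show Label m (d + 2) from p) 1) =
      ∑ j ∈ p.A, sign j p.A •
        ((X j : MvPolynomial (Fin m) k) • e k m d p.i (p.A.erase j) -
          (X 0 ^ b S m p.i j : MvPolynomial (Fin m) k) • e k m d (p.i + j) (p.A.erase j)) :=
  (Finsupp.linearCombination_single _ _ _).trans (one_smul _ _)

theorem range_boundary_le {d : ℕ} {N : Submodule (MvPolynomial (Fin m) k) (F k m d)}
    (h : ∀ p : Label m (d + 1), boundary k S m d (Finsupp.single p 1) ∈ N) :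
    LinearMap.range (boundary k S m d) ≤ N := by
  rintro _ ⟨x, rfl⟩
  induction x using Finsupp.induction_linear with
  | zero => simp
  | add x y hx hy => rw [map_add]; exact add_mem hx hy
  | single p r =>
    rw [← mul_one r, ← smul_eq_mul, ← Finsupp.smul_single, map_smul]
    exact N.smul_mem r (h p)

theorem isMinimal_of_b_pos (hb : ∀ i j : Fin m, i ≠ 0 → j ≠ 0 → 0 < b S m i j) :
    IsMinimal k S m := by
  have hX : ∀ i : Fin m, (X i : MvPolynomial (Fin m) k) ∈
      Ideal.span (Set.range (X : Fin m → MvPolynomial (Fin m) k)) :=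
    fun i => Ideal.subset_span ⟨i, rfl⟩
  intro d
  refine range_boundary_le fun p => ?_
  cases d with
  | zero =>
    refine (congrArg (· ∈ _) (boundary_zero_single p)).mpr (Submodule.sum_mem _ fun j _ => ?_)
    -- Both terms of the binomial keep a variable factor even if `c` is `0`.
    rw [← mul_one (_ - _), ← smul_eq_mul, ← Finsupp.smul_single]
    exact Submodule.smul_mem_smul
      (sub_mem (Ideal.mul_mem_left _ _ (hX _)) (Ideal.mul_mem_left _ _ (hX _))) trivial
  | succ d =>
    refine (congrArg (· ∈ _) (boundary_succ_single d p)).mpr (Submodule.sum_mem _ fun j hj =>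
      zsmul_mem (sub_mem ?_ ?_) _)
    · exact Submodule.smul_mem_smul (hX _) trivial
    · have hj0 : j ≠ 0 := fun h => p.zero_notMem (h ▸ hj)
      exact Submodule.smul_mem_smul
        (Ideal.pow_mem_of_mem _ (hX _) _ (hb _ _ p.i_ne_zero hj0)) trivial

theorem noConstantEntries_of_isMinimal (h : IsMinimal k S m) : NoConstantEntries k S m := by
  intro d q p u hu heq
  have hmem := h d (LinearMap.mem_range_self _ (Finsupp.single p 1))
  have hq : entry k S m d q p ∈
      Ideal.span (Set.range (X : Fin m → MvPolynomial (Fin m) k)) := by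
    unfold entry
    generalize boundary k S m d (Finsupp.single p 1) = z at hmem
    induction hmem using Submodule.smul_induction_on' with
    | smul r hr x _ => exact Ideal.mul_mem_right (x q) _ hr
    | add x _ y _ hx hy => exact add_mem hx hy
  have hle : Ideal.span (Set.range (X : Fin m → MvPolynomial (Fin m) k)) ≤
      RingHom.ker (constantCoeff (σ := Fin m) (R := k)) := by
    rw [Ideal.span_le]
    rintro _ ⟨i, rfl⟩
    simp [RingHom.mem_ker]
  have := hle hq
  rw [heq, RingHom.mem_ker, constantCoeff_C] at this
  exact hu this

/-- The label of the basis vector `e_{l,{l}}` of `F_1`. -/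
def diagLabel {l : Fin m} (hl : l ≠ 0) : Label m 1 :=
  (⟨l, {l}, hl, by simpa using hl.symm, rfl, l, by simp, le_rfl⟩ : BasisLabel m 1)

theorem basisVec_apply_of_ne {d : ℕ} {i : Fin m} {A : Finset (Fin m)} {q : BasisLabel m (d + 1)}
    (h : i ≠ q.i ∨ A ≠ q.A) : basisVec k m d i A (show Label m (d + 1) from q) = 0 := by
  unfold basisVec
  split_ifs with h'
  · refine Finsupp.single_eq_of_ne fun heq => ?_
    subst heq
    simp at h
  · rfl

theorem e_self_apply_diagLabel {l : Fin m} (hl : l ≠ 0) :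
    e k m 0 l {l} (diagLabel hl) = 1 := by
  rw [e, if_neg hl, if_pos ⟨l, by simp, le_rfl⟩, basisVec, dif_pos
    ⟨hl, by simpa using hl.symm, rfl, l, by simp, le_rfl⟩]
  exact Finsupp.single_eq_same

/-- Rewriting `e_{i,{j}}` with `i < j` gives `e_{j,{i}}`, which is again off the diagonal. -/
theorem e_singleton_apply_diagLabel_of_ne {l i j : Fin m} (hl : l ≠ 0) (h : i ≠ l ∨ j ≠ l) :
    e k m 0 i {j} (diagLabel hl) = 0 := by
  rw [e]
  split_ifs with h0 h1
  · rfl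
  · exact basisVec_apply_of_ne (h.imp id (by simp [diagLabel]))
  · have hij : i ≠ j := fun hij => h1 ⟨j, by simp, hij.ge⟩
    have he : (insert i {j} : Finset (Fin m)).erase j = {i} := by
      ext x
      simp only [Finset.mem_erase, Finset.mem_insert, Finset.mem_singleton]
      grind
    rw [Finset.sum_singleton, Finsupp.smul_apply, he]
    refine (congrArg _ (basisVec_apply_of_ne (h.symm.imp id ?_))).trans (smul_zero _)
    simp [diagLabel]

/-- If `b_{i,j} = 0`, the coefficient of `e_{i+j,{i+j}}` in `∂ e_{i,{j,i+j}}` is `± 1`. -/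
theorem exists_entry_eq_C (hS : ((S : Set ℕ)ᶜ).Finite)
    (hm : IsLeast {n : ℕ | n ∈ S ∧ n ≠ 0} m) {i j : Fin m} (hi : i ≠ 0) (hj : j ≠ 0)
    (hji : j ≤ i) (hb : b S m i j = 0) :
    ∃ (q : Label m 1) (p : Label m 2) (u : k), u ≠ 0 ∧ entry k S m 1 q p = C u := by
  obtain ⟨hk, -⟩ := a_add_of_b_eq_zero hS hm hi hb
  have hik : i ≠ i + j := fun h => hj (by simpa using h)
  have hjk : j ≠ i + j := fun h => hi (by simpa using h)
  -- `j ≤ i` is what makes this pair an admissible label.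
  let p : BasisLabel m 2 := ⟨i, {j, i + j}, hi, by
    simp only [Finset.mem_insert, Finset.mem_singleton, not_or]
    exact ⟨hj.symm, hk.symm⟩, Finset.card_pair hjk, j, by simp, hji⟩
  refine ⟨diagLabel hk, p, -((sign j {j, i + j} : ℤ) : k), ?_, ?_⟩
  · unfold sign
    simp
  · have e1 : ({j, i + j} : Finset (Fin m)).erase j = {i + j} := by
      ext x
      simp only [Finset.mem_erase, Finset.mem_insert, Finset.mem_singleton]
      grind
    have e2 : ({j, i + j} : Finset (Fin m)).erase (i + j) = {j} := by
      ext x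
      simp only [Finset.mem_erase, Finset.mem_insert, Finset.mem_singleton]
      grind
    refine (congrArg (fun x : F k m 1 => x (diagLabel hk)) (boundary_succ_single 0 p)).trans ?_
    simp only [p]
    rw [Finset.sum_pair hjk, e1, e2, hb]
    simp only [Finsupp.add_apply, Finsupp.smul_apply, Finsupp.sub_apply]
    -- Of the four terms only `y^0 e_{i+j,{i+j}}` meets the diagonal row.
    rw [e_self_apply_diagLabel, e_singleton_apply_diagLabel_of_ne hk (Or.inl hik),
      e_singleton_apply_diagLabel_of_ne hk (Or.inr hjk),
      e_singleton_apply_diagLabel_of_ne hk (Or.inr hjk)]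
    simp

theorem b_pos_of_noConstantEntries (hS : ((S : Set ℕ)ᶜ).Finite)
    (hm : IsLeast {n : ℕ | n ∈ S ∧ n ≠ 0} m) (h : NoConstantEntries k S m)
    (i j : Fin m) (hi : i ≠ 0) (hj : j ≠ 0) : 0 < b S m i j := by
  by_contra hb
  have hb0 := Nat.eq_zero_of_not_pos hb
  -- `b` is symmetric, so the smaller index can be put into the set `A`.
  rcases le_total j i with hji | hij
  · obtain ⟨q, p, u, hu, he⟩ := exists_entry_eq_C (k := k) hS hm hi hj hji hb0
    exact h 1 q p u hu he
  · obtain ⟨q, p, u, hu, he⟩ := exists_entry_eq_C (k := k) hS hm hj hi hij (b_comm i j ▸ hb0)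
    exact h 1 q p u hu he

end Resolution

end Apery

theorem corollary3p4 (k : Type*) [Field k] (m : ℕ) [NeZero m] (hm : 2 ≤ m)
    (S : AddSubmonoid ℕ) (hS : ((S : Set ℕ)ᶜ).Finite)
    (hmult : IsLeast {n : ℕ | n ∈ S ∧ n ≠ 0} m) :
    List.TFAE [
      Apery.IsMinimal k S m,
      Apery.NoConstantEntries k S m,
      Apery.IsMED S m,
      ∀ i j : Fin m, i ≠ 0 → j ≠ 0 → 0 < Apery.b S m i j,
      Apery.coordVector S m ∈ interior (Apery.kunzCone m)] := by
  tfae_have 1 → 2 := Apery.noConstantEntries_of_isMinimal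
  tfae_have 2 → 4 := Apery.b_pos_of_noConstantEntries hS hmult
  tfae_have 4 → 1 := Apery.isMinimal_of_b_pos
  tfae_have 3 ↔ 4 := Apery.isMED_iff hS hmult
  tfae_have 5 ↔ 4 := Apery.coordVector_mem_interior_iff hS hmult
  tfae_finish
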